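/- Conventions. All rings are commutative with unity. For a domain $B$ of characteristic zero, $\mathrm{LND}(B)$ is the set of derivations $D:B\to B$ such that for every $x\in B$ there is $n\in\mathbb N$ with $D^n(x)=0$; $\mathrm{ML}(B)=\bigcap_{D\in \mathrm{LND}(B)}\ker D$; for $\Delta\subseteq \mathrm{LND}(B)$, $K_\Delta=\bigcap_{D\in\Delta}\mathrm{Frac}(\ker D)$, the intersection being taken in $\mathrm{Frac}\,B$ (so $K_\emptyset=\mathrm{Frac}\,B$); and $\mathcal K(B)=\{K_\Delta : \Delta\subseteq \mathrm{LND}(B)\}$. For a field $K$, $K^{(2)}$ is the field of fractions of the polynomial ring in two variables over $K$. For a field $k$, an affine $k$-domain is a domain that is a finitely generated $k$-algebra. A $k$-domain $B$ is rational over $k$ if $\mathrm{Frac}\,B$ is a purely transcendental extension of $k$, and unirational over $k$ if there is a field $F$ with $k\subseteq \mathrm{Frac}\,B\subseteq F$ and $F$ purely transcendental over $k$. Proposition. Let $k$ be a field of characteristic zero. Let $K/k$ be a finitely generated extension of fields. (a) There exists an affine $k$-domain $B$ such that $\mathrm{Frac}\,B=K^{(2)}$, $\mathrm{ML}(B)=k$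 and $K\in\mathcal K(B)$. (b) There exists a normal affine $k$-domain $B$ such that $\mathrm{Frac}\,B=K^{(2)}$, $\mathrm{ML}(B)=k'$ and $K\in\mathcal K(B)$, where $k'$ is the algebraic closure of $k$ in $K$. Moreover, the following holds, independently of any choice of $K$: (c) For every integer $d\ge 3$ there exists a normal affine $k$-domain $B$ such that $\dim B=d$, $\mathrm{ML}(B)=k$, and $B$ is not unirational (hence not rational) over $k$. -/

import Mathlib

universe u v

/-- The set `LND(B)` of locally nilpotent derivations `D : B → B` of a ring `B`
(additive maps satisfying the Leibniz rule, no linearity over a base field is imposed). -/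
def LND (B : Type u) [CommRing B] : Set (Derivation ℤ B B) :=
  {D | ∀ x : B, ∃ n : ℕ, (⇑D)^[n] x = 0}

/-- The kernel of a derivation `D : B → B`, as a subring of `B`. -/
def derivationKer {B : Type u} [CommRing B] (D : Derivation ℤ B B) : Subring B where
  carrier := {x | D x = 0}
  mul_mem' := by
    intro a b ha hb
    simp only [Set.mem_ofPred_eq] at *
    simp [ha, hb]
  one_mem' := by simp
  add_mem' := by
    intro a b ha hb
    simp only [Set.mem_ofPred_eq] at *
    simp [ha, hb]
  zero_mem' := by simp
  neg_mem' := by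
    intro a ha
    simp only [Set.mem_ofPred_eq] at *
    simp [ha]

/-- `A_Δ = ⋂_{D ∈ Δ} ker D`, the intersection being taken in `B` (so `A_∅ = B`). -/
def kerInter (B : Type u) [CommRing B] (Δ : Set (Derivation ℤ B B)) : Subring B :=
  ⨅ D ∈ Δ, derivationKer D

/-- The Makar-Limanov invariant `ML(B) = ⋂_{D ∈ LND(B)} ker D`. -/
def makarLimanov (B : Type u) [CommRing B] : Subring B :=
  kerInter B (LND B)

/-- `Frac A` inside `L`, for a subring `A` of a domain `B` with field of fractions `L`. -/
def fracIn {B : Type u} [CommRing B] (L : Type v) [Field L] [Algebra B L] (A : Subring B) :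
    Subfield L :=
  Subfield.closure (algebraMap B L '' (A : Set B))

/-- `K_Δ = ⋂_{D ∈ Δ} Frac (ker D)`, the intersection being taken in `L = Frac B`
(so `K_∅ = Frac B`). -/
def fracKerInter (B : Type u) [CommRing B] (L : Type v) [Field L] [Algebra B L]
    (Δ : Set (Derivation ℤ B B)) : Subfield L :=
  ⨅ D ∈ Δ, fracIn L (derivationKer D)

/-- The set `𝒦(B) = {K_Δ : Δ ⊆ LND(B)}` of subfields of `L = Frac B`. -/
def fieldLattice (B : Type u) [CommRing B] (L : Type v) [Field L] [Algebra B L]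
    [IsFractionRing B L] : Set (Subfield L) :=
  {M | ∃ Δ : Set (Derivation ℤ B B), Δ ⊆ LND B ∧ M = fracKerInter B L Δ}

/-- `K^(2)`, the field of fractions of the polynomial ring in two variables over `K`. -/
abbrev RatFunc₂ (K : Type u) [Field K] : Type u :=
  FractionRing (MvPolynomial (Fin 2) K)

/-- `F / k` is purely transcendental: `F = k(s)` for some algebraically independent `s ⊆ F`. -/
def IsPurelyTranscendental (k : Type u) (F : Type v) [Field k] [Field F] [Algebra k F] : Prop :=
  ∃ s : Set F, AlgebraicIndependent k ((↑) : s → F) ∧ IntermediateField.adjoin k s = ⊤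

/-- The `k`-domain `R` is rational over `k`: `Frac R` is purely transcendental over `k`. -/
def IsRationalOver (k : Type u) (R : Type v) [Field k] [CommRing R] [IsDomain R] [Algebra k R] :
    Prop :=
  IsPurelyTranscendental k (FractionRing R)

/-- The `k`-domain `R` is unirational over `k`: `Frac R` embeds over `k` in some purely
transcendental extension of `k`. -/
def IsUnirationalOver (k : Type u) (R : Type v) [Field k] [CommRing R] [IsDomain R]
    [Algebra k R] : Prop :=
  ∃ (F : Type (max u v)) (_ : Field F) (_ : Algebra k F),
    IsPurelyTranscendental k F ∧ Nonempty (FractionRing R →ₐ[k] F)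

/-! Let `s` be a finite set generating the field K over k, and let A be the k-algebra generated by
the X_i and the aX_i with a in `s`. Since a = aX_i / X_i, A has fraction field K(X_0, X_1), although
every element of A has constant term in k. The derivations X_1 ∂/∂X_0 and X_0 ∂/∂X_1 are locally
nilpotent and preserve A. Together they kill only constants, so ML(A) lies in K ∩ A = k; equality
holds because locally nilpotent derivations kill units. The fraction fields of their two kernels
contain K and lie in K(X_1) and K(X_0), so they meet in K. This gives (a).

For (b), A is replaced by its integral closure, which stays inside K[X_0, X_1]. It is still stable
under both derivations (`isIntegral_crossDeriv`), and setting X = 0 shows that its constants are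
exactly the elements of K algebraic over k. `IsConeLike` collects what the two algebras share.

For (c), take K to be the function field of the cubic 2z³ = 1 + w³. Expansion at the rational point
(1, 1) embeds K in Frac k⟦X⟧, so k is algebraically closed in K and (b) gives a normal example of
dimension 1 + 2 = 3. By Mason–Stothers the cubic has only constant points in a purely transcendental
extension, so the example is not unirational. Adjoining polynomial variables raises the dimension.
-/

section LocallyNilpotent

/-! ### Locally nilpotent derivations -/

variable {B : Type u} [CommRing B]

theorem mem_makarLimanov {x : B} : x ∈ makarLimanov B ↔ ∀ D ∈ LND B, D x = 0 := by
  simp only [makarLimanov, kerInter, Subring.mem_iInf]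
  rfl

/-- In the Leibniz expansion every other term differentiates one factor too often. The constant is a
binomial coefficient, but only its being nonzero matters. -/
theorem Derivation.exists_iterate_mul_eq (D : Derivation ℤ B B) (N : ℕ) :
    ∀ (n m : ℕ) (a b : B), n + m = N → (⇑D)^[n + 1] a = 0 → (⇑D)^[m + 1] b = 0 →
      ∃ c : ℕ, c ≠ 0 ∧ (⇑D)^[N] (a * b) = c * ((⇑D)^[n] a * (⇑D)^[m] b) := by
  have hadd : ∀ (N : ℕ) (x y : B), (⇑D)^[N] (x + y) = (⇑D)^[N] x + (⇑D)^[N] y :=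
    fun N x y => iterate_map_add D N x y
  induction N with
  | zero =>
    intro n m a b h _ _
    obtain ⟨rfl, rfl⟩ : n = 0 ∧ m = 0 := by omega
    exact ⟨1, one_ne_zero, by simp⟩
  | succ N ih =>
    have hleft : ∀ (m : ℕ) (a b : B), D a = 0 → (⇑D)^[m] (a * b) = a * (⇑D)^[m] b := by
      intro m
      induction m with
      | zero => intro a b _; rfl
      | succ m ihm =>
        intro a b ha
        rw [Function.iterate_succ_apply, D.leibniz, ha]
        simp [ihm a _ ha]
    intro n m a b h ha hb
    rcases n with _ | n
    · refine ⟨1, one_ne_zero, ?_⟩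
      obtain rfl : m = N + 1 := by omega
      simpa using hleft (N + 1) a b ha
    rcases m with _ | m
    · refine ⟨1, one_ne_zero, ?_⟩
      obtain rfl : n = N := by omega
      rw [mul_comm a b, hleft _ _ _ hb]
      simp [mul_comm]
    obtain ⟨c₁, hc₁, h₁⟩ := ih n (m + 1) (D a) b (by omega)
      (by rwa [← Function.iterate_succ_apply]) hb
    obtain ⟨c₂, -, h₂⟩ := ih (n + 1) m a (D b) (by omega) ha
      (by rwa [← Function.iterate_succ_apply])
    refine ⟨c₁ + c₂, by omega, ?_⟩
    rw [Function.iterate_succ_apply, D.leibniz, hadd, smul_eq_mul, smul_eq_mul,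
      mul_comm b (D a), h₁, h₂, ← Function.iterate_succ_apply, ← Function.iterate_succ_apply]
    push_cast
    ring

theorem exists_iterate_ne_zero {D : Derivation ℤ B B} (hD : D ∈ LND B) {a : B} (ha : a ≠ 0) :
    ∃ n : ℕ, (⇑D)^[n] a ≠ 0 ∧ (⇑D)^[n + 1] a = 0 := by
  classical
  have h := hD a
  have h0 : Nat.find h ≠ 0 := by
    intro h0
    have := Nat.find_spec h
    rw [h0] at this
    exact ha this
  obtain ⟨n, hn⟩ := Nat.exists_eq_succ_of_ne_zero h0
  refine ⟨n, Nat.find_min h (by omega), ?_⟩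
  have := Nat.find_spec h
  rwa [hn] at this

/-- The nilpotency degree is additive on products in characteristic zero, and 1 has degree 0, so a
unit has degree 0. -/
theorem apply_eq_zero_of_mul_eq_one [IsDomain B] [CharZero B] {D : Derivation ℤ B B}
    (hD : D ∈ LND B) {a b : B} (hab : a * b = 1) : D a = 0 := by
  obtain ⟨n, hn, hn'⟩ := exists_iterate_ne_zero hD (left_ne_zero_of_mul_eq_one hab)
  obtain ⟨m, hm, hm'⟩ := exists_iterate_ne_zero hD (right_ne_zero_of_mul_eq_one hab)
  obtain ⟨c, hc, h⟩ := D.exists_iterate_mul_eq (n + m) n m a b rfl hn' hm'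
  rcases Nat.eq_zero_or_pos (n + m) with h0 | h0
  · obtain rfl : n = 0 := by omega
    simpa using hn'
  · exfalso
    obtain ⟨N, hN⟩ := Nat.exists_eq_succ_of_ne_zero h0.ne'
    rw [hab, hN, Function.iterate_succ_apply, D.map_one_eq_zero, iterate_map_zero] at h
    exact mul_ne_zero (Nat.cast_ne_zero.mpr hc) (mul_ne_zero hn hm) h.symm

theorem algebraMap_range_le_makarLimanov (k : Type*) [Field k] [IsDomain B] [CharZero B]
    [Algebra k B] : (algebraMap k B).range ≤ makarLimanov B := by
  rintro _ ⟨c, rfl⟩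
  rw [mem_makarLimanov]
  intro D hD
  rcases eq_or_ne c 0 with rfl | hc
  · simp
  · exact apply_eq_zero_of_mul_eq_one hD (b := algebraMap k B c⁻¹)
      (by rw [← map_mul, mul_inv_cancel₀ hc, map_one])

-- d/dT leaves only constant polynomials, and each locally nilpotent derivation of the base extends
-- coefficientwise.
open Polynomial in
theorem makarLimanov_polynomial_le [IsDomain B] [CharZero B] {p : B[X]}
    (hp : p ∈ makarLimanov B[X]) : ∃ b ∈ makarLimanov B, p = C b := by
  rw [mem_makarLimanov] at hp
  have h1 : derivative p = 0 := by
    have := hp ((Polynomial.derivative' (R := B)).restrictScalars ℤ) fun q => by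
      refine ⟨q.natDegree + 1, ?_⟩
      exact iterate_derivative_eq_zero (Nat.lt_succ_self _)
    exact this
  obtain ⟨b, rfl⟩ : ∃ b, p = C b := ⟨_, eq_C_of_derivative_eq_zero h1⟩
  refine ⟨b, mem_makarLimanov.mpr fun D hD => ?_, rfl⟩
  let : Differential B := ⟨D⟩
  have hcoeff : ∀ (n : ℕ) (q : B[X]) (i : ℕ),
      ((⇑(Differential.mapCoeffs (A := B)))^[n] q).coeff i = (⇑D)^[n] (q.coeff i) := by
    intro n
    induction n with
    | zero => intros; rfl
    | succ n ih =>
      intro q i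
      rw [Function.iterate_succ_apply, ih, Function.iterate_succ_apply]
      rfl
  have hnil : ∀ q : B[X], ∃ n : ℕ, (⇑(Differential.mapCoeffs (A := B)))^[n] q = 0 := fun q => by
    choose f hf using fun i : ℕ => hD (q.coeff i)
    refine ⟨q.support.sup f, ?_⟩
    ext i
    rw [hcoeff, coeff_zero]
    by_cases hi : i ∈ q.support
    · obtain ⟨c, hc⟩ := Nat.exists_eq_add_of_le' (Finset.le_sup (f := f) hi)
      rw [hc, Function.iterate_add_apply, hf, iterate_map_zero]
    · rw [notMem_support_iff.mp hi, iterate_map_zero]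
  have h0 : Differential.mapCoeffs (C b) = 0 := hp Differential.mapCoeffs hnil
  have h2 : (Differential.mapCoeffs (C b)).coeff 0 = D b := by
    rw [Differential.coeff_mapCoeffs, coeff_C_zero]
    rfl
  rw [← h2, h0, coeff_zero]

end LocallyNilpotent

/-! ### Integral extensions and finiteness of integral closure -/

/-- Incomparability bounds the dimension above; lying over and going up lift chains. -/
theorem ringKrullDim_eq_of_isIntegral (R : Type*) (S : Type*) [CommRing R] [CommRing S]
    [Algebra R S] [Algebra.IsIntegral R S] [FaithfulSMul R S] :
    ringKrullDim S = ringKrullDim R := by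
  apply le_antisymm
  · refine Order.krullDim_le_of_strictMono (PrimeSpectrum.comap (algebraMap R S)) ?_
    intro p q hpq
    exact Ideal.IsIntegral.comap_lt_comap hpq
  · refine iSup_le fun l => ?_
    obtain ⟨Q, -, hQ, hQ'⟩ := Ideal.exists_ideal_over_prime_of_isIntegral
      (S := S) l.head.asIdeal ⊥ (by simp [← RingHom.ker_eq_comap_bot])
    have : Q.LiesOver l.head.asIdeal := ⟨hQ'.symm⟩
    obtain ⟨M, hM, -⟩ := Ideal.exists_ltSeries_of_hasGoingUp l Q
    rw [← hM]
    exact Order.LTSeries.length_le_krullDim M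

/-- By Noether normalization A is finite over a polynomial ring P, and both have the same integral
closure in L. As P is normal and L is finite separable over Frac P, that closure is finite over P.
-/
theorem finiteType_integralClosure (k A L : Type*) [Field k] [CharZero k] [CommRing A] [Field L]
    [Algebra k A] [Algebra A L] [Algebra k L] [IsScalarTower k A L] [IsFractionRing A L]
    [Algebra.FiniteType k A] :
    Algebra.FiniteType k ((integralClosure A L).restrictScalars k) := by
  have : IsDomain A := (IsFractionRing.injective A L).isDomain
  obtain ⟨s, g, hg, hfin⟩ := exists_finite_inj_algHom_of_fg k A
  let : Algebra (MvPolynomial (Fin s) k) A := g.toRingHom.toAlgebra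
  have : IsScalarTower k (MvPolynomial (Fin s) k) A := .of_algHom g
  let : Algebra (MvPolynomial (Fin s) k) L :=
    ((algebraMap A L).comp g.toRingHom).toAlgebra
  have : IsScalarTower (MvPolynomial (Fin s) k) A L := .of_algebraMap_eq fun _ => rfl
  have : IsScalarTower k (MvPolynomial (Fin s) k) L := .of_algebraMap_eq fun x => by
    rw [IsScalarTower.algebraMap_apply k A L,
      IsScalarTower.algebraMap_apply k (MvPolynomial (Fin s) k) A,
      ← IsScalarTower.algebraMap_apply (MvPolynomial (Fin s) k) A L]
  have : Module.Finite (MvPolynomial (Fin s) k) A := hfin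
  have hinjL : Function.Injective (algebraMap (MvPolynomial (Fin s) k) L) :=
    (IsFractionRing.injective A L).comp hg
  have : FaithfulSMul (MvPolynomial (Fin s) k) L :=
    (faithfulSMul_iff_algebraMap_injective _ _).mpr hinjL
  have : FaithfulSMul (MvPolynomial (Fin s) k) A :=
    (faithfulSMul_iff_algebraMap_injective _ _).mpr hg
  let := FractionRing.liftAlgebra (MvPolynomial (Fin s) k) L
  have := FractionRing.isScalarTower_liftAlgebra (MvPolynomial (Fin s) k) L
  have : FiniteDimensional (FractionRing (MvPolynomial (Fin s) k)) L :=
    .of_isLocalization (MvPolynomial (Fin s) k) A (nonZeroDivisors (MvPolynomial (Fin s) k))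
  have hf : Module.Finite (MvPolynomial (Fin s) k)
      (integralClosure (MvPolynomial (Fin s) k) L) :=
    IsIntegralClosure.finite _ (FractionRing (MvPolynomial (Fin s) k)) L _
  have h2 : Algebra.FiniteType k (integralClosure (MvPolynomial (Fin s) k) L) :=
    .trans (S := MvPolynomial (Fin s) k) inferInstance inferInstance
  have heq : (integralClosure (MvPolynomial (Fin s) k) L).restrictScalars k =
      (integralClosure A L).restrictScalars k := by
    ext x
    exact ⟨fun h => IsIntegral.tower_top (A := A) h, fun h => isIntegral_trans _ h⟩
  rw [← heq]
  exact h2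

open MvPolynomial in
theorem MvPolynomial.notMem_vars_of_pderiv_eq_zero {σ K : Type*} [Field K] [CharZero K]
    {i : σ} {f : MvPolynomial σ K} (hf : pderiv i f = 0) : i ∉ f.vars := by
  classical
  rw [mem_vars_iff_mem_support]
  rintro ⟨m, hm, him⟩
  have h := coeff_pderiv (i := i) f (m - Finsupp.single i 1)
  rw [hf, coeff_zero, tsub_add_cancel_of_le] at h
  · rcases mul_eq_zero.mp h.symm with h | h
    · exact mem_support_iff.mp hm h
    · exact Nat.cast_add_one_ne_zero _ h
  · rw [Finsupp.single_le_iff]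
    exact Nat.one_le_iff_ne_zero.mpr (Finsupp.mem_support_iff.mp him)

/-! ### The derivations X_j ∂/∂X_i and their shears -/

section CrossDeriv

open MvPolynomial

variable (K : Type v) [Field K]

/-- The derivation `X j * ∂ / ∂ X i` of `K[X 0, X 1]`. -/
noncomputable def crossDeriv (i j : Fin 2) :
    Derivation K (MvPolynomial (Fin 2) K) (MvPolynomial (Fin 2) K) :=
  (X j : MvPolynomial (Fin 2) K) • pderiv i

/-- The substitution `X i ↦ X i + t * X j` of `K[X 0, X 1]`, with values in `K[X 0, X 1][t]`. -/
noncomputable def shear (i j : Fin 2) :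
    MvPolynomial (Fin 2) K →ₐ[K] Polynomial (MvPolynomial (Fin 2) K) :=
  aeval fun l => Polynomial.C (X l) + if l = i then Polynomial.C (X j) * Polynomial.X else 0

variable {K}

theorem crossDeriv_apply (i j : Fin 2) (f : MvPolynomial (Fin 2) K) :
    crossDeriv K i j f = X j * pderiv i f := rfl

theorem crossDeriv_eq_zero_iff {i j : Fin 2} {f : MvPolynomial (Fin 2) K} :
    crossDeriv K i j f = 0 ↔ pderiv i f = 0 := by
  rw [crossDeriv_apply, mul_eq_zero, or_iff_right (X_ne_zero j)]

theorem crossDeriv_X_of_ne {i j l : Fin 2} (h : l ≠ i) :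
    crossDeriv K i j (X l) = 0 := by
  rw [crossDeriv_apply, pderiv_X_of_ne h, mul_zero]

theorem crossDeriv_X_self (i j : Fin 2) : crossDeriv K i j (X i) = X j := by
  rw [crossDeriv_apply, pderiv_X_self, mul_one]

/-- Each application lowers the exponent of X_i, and the factor X_j does not restore it because i ≠
j. -/
theorem exists_iterate_crossDeriv_eq_zero {i j : Fin 2} (hij : i ≠ j)
    (f : MvPolynomial (Fin 2) K) : ∃ n : ℕ, (⇑(crossDeriv K i j))^[n] f = 0 := by
  have hmon : ∀ (n : ℕ) (m : Fin 2 →₀ ℕ) (a : K), m i = n →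
      (⇑(crossDeriv K i j))^[n + 1] (monomial m a) = 0 := by
    intro n
    induction n with
    | zero =>
      intro m a hm
      simp [crossDeriv_apply, pderiv_monomial, hm]
    | succ n ih =>
      intro m a hm
      rw [Function.iterate_succ_apply, crossDeriv_apply, pderiv_monomial, X, monomial_mul]
      apply ih
      simp [hm, hij.symm]
  induction f using MvPolynomial.induction_on' with
  | monomial m a => exact ⟨_, hmon _ m a rfl⟩
  | add f g hf hg =>
    obtain ⟨n, hn⟩ := hf
    obtain ⟨l, hl⟩ := hg
    refine ⟨n + l, ?_⟩
    rw [iterate_map_add, Function.iterate_add_apply _ n l g, hl, add_comm n,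
      Function.iterate_add_apply, hn, iterate_map_zero, iterate_map_zero, add_zero]

/-- The shear is the exponential of tD, so it is 1 + tD modulo t². -/
theorem shear_coeff (i j : Fin 2) (f : MvPolynomial (Fin 2) K) :
    (shear K i j f).coeff 0 = f ∧ (shear K i j f).coeff 1 = crossDeriv K i j f := by
  induction f using MvPolynomial.induction_on with
  | C a =>
    have : shear K i j (C a) = Polynomial.C (C a) := by
      rw [shear, algHom_C]
      rfl
    rw [this]
    simp
  | add p q hp hq => simp [hp.1, hp.2, hq.1, hq.2]
  | mul_X p l hp =>
    have h0 : (shear K i j (X l)).coeff 0 = X l := by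
      by_cases h : l = i <;> simp [shear, h]
    have h1 : (shear K i j (X l)).coeff 1 = crossDeriv K i j (X l) := by
      by_cases h : l = i
      · subst h
        simp [shear, crossDeriv_X_self, Polynomial.coeff_C]
      · simp [shear, h, crossDeriv_X_of_ne h]
    rw [map_mul, Polynomial.mul_coeff_zero, Polynomial.mul_coeff_one, Derivation.leibniz,
      h0, h1, hp.1, hp.2]
    exact ⟨rfl, by simp only [smul_eq_mul]; ring⟩

end CrossDeriv

/-! ### The cone algebra and integrality over it -/

section ConeAlgebra

open MvPolynomial

variable (k : Type u) {K : Type v} [Field k] [Field K] [Algebra k K]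

/-- The `k`-algebra generated by `X 0`, `X 1` and the products `a * X 0`, `a * X 1`
with `a ∈ s`. -/
noncomputable def coneAlgebra (s : Set K) : Subalgebra k (MvPolynomial (Fin 2) K) :=
  Algebra.adjoin k (Set.image2 (fun (a : K) (i : Fin 2) => C a * X i) (insert 1 s) Set.univ)

variable {k}

theorem C_mul_X_mem_coneAlgebra {s : Set K} {a : K} (ha : a ∈ insert 1 s) (i : Fin 2) :
    C a * X i ∈ coneAlgebra k s :=
  Algebra.subset_adjoin ⟨a, ha, i, trivial, rfl⟩

theorem finiteType_coneAlgebra {s : Set K} (hs : s.Finite) :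
    Algebra.FiniteType k (coneAlgebra k s) :=
  (Subalgebra.fg_iff_finiteType _).mp <| Subalgebra.fg_def.mpr
    ⟨_, (hs.insert 1).image2 _ Set.finite_univ, rfl⟩

/-- The factor X_j is essential: aX_i goes to aX_j, whereas ∂/∂X_i alone would produce a, which need
not lie in the algebra. -/
theorem crossDeriv_mem_coneAlgebra {s : Set K} (i j : Fin 2) {f : MvPolynomial (Fin 2) K}
    (hf : f ∈ coneAlgebra k s) : crossDeriv K i j f ∈ coneAlgebra k s := by
  induction hf using Algebra.adjoin_induction with
  | mem x hx =>
    obtain ⟨a, ha, l, -, rfl⟩ := hx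
    change crossDeriv K i j (C a * X l) ∈ _
    rw [← smul_eq_C_mul, Derivation.map_smul]
    by_cases h : l = i
    · rw [h, crossDeriv_X_self, smul_eq_C_mul]
      exact C_mul_X_mem_coneAlgebra ha j
    · rw [crossDeriv_X_of_ne h, smul_zero]
      exact zero_mem _
  | algebraMap c =>
    rw [IsScalarTower.algebraMap_apply k K, Derivation.map_algebraMap]
    exact zero_mem _
  | add x y hx hy hx' hy' => rw [map_add]; exact add_mem hx' hy'
  | mul x y hx hy hx' hy' =>
    rw [Derivation.leibniz]
    exact add_mem (mul_mem hx hy') (mul_mem hy hx')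

theorem constantCoeff_mem_of_mem_coneAlgebra {s : Set K} {f : MvPolynomial (Fin 2) K}
    (hf : f ∈ coneAlgebra k s) : constantCoeff f ∈ (algebraMap k K).range := by
  induction hf using Algebra.adjoin_induction with
  | mem x hx =>
    obtain ⟨a, ha, l, -, rfl⟩ := hx
    rw [map_mul, constantCoeff_X, mul_zero]
    exact zero_mem _
  | algebraMap c =>
    rw [IsScalarTower.algebraMap_apply k K, MvPolynomial.algebraMap_eq, constantCoeff_C]
    exact ⟨c, rfl⟩
  | add x y hx hy hx' hy' => rw [map_add]; exact add_mem hx' hy'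
  | mul x y hx hy hx' hy' => rw [map_mul]; exact mul_mem hx' hy'

/-- Evaluation at the origin sends the cone algebra to k and fixes a, so it turns the integral
equation into one over k. -/
theorem isIntegral_of_isIntegral_C {s : Set K} {a : K}
    (ha : IsIntegral (coneAlgebra k s) (C a : MvPolynomial (Fin 2) K)) : IsIntegral k a := by
  let φ : coneAlgebra k s →ₐ[k] (⊥ : Subalgebra k K) :=
    ((aeval (0 : Fin 2 → K)).restrictScalars k |>.comp (coneAlgebra k s).val).codRestrict _
      fun f => by
        obtain ⟨c, hc⟩ := constantCoeff_mem_of_mem_coneAlgebra f.2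
        exact Algebra.mem_bot.mpr ⟨c, by simpa [aeval_zero] using hc⟩
  have h : ∀ x, algebraMap k K (Algebra.botEquiv k K (φ x)) = aeval (0 : Fin 2 → K) x.1 :=
    fun x => congrArg Subtype.val ((Algebra.botEquiv k K).symm_apply_apply (φ x))
  have := ha.map_of_comp_eq ((Algebra.botEquiv k K).toRingHom.comp φ.toRingHom)
    (aeval (0 : Fin 2 → K)).toRingHom (by ext1 x; exact h x)
  simpa [aeval_zero] using this

/-- The shear carries the cone algebra A into A[t], since aX_i goes to aX_i + aX_j t. Hence it sends
f to an element integral over A[t], whose coefficients are integral over A; the coefficient of t is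
the derivative. -/
theorem isIntegral_crossDeriv {s : Set K} (i j : Fin 2) {f : MvPolynomial (Fin 2) K}
    (hf : IsIntegral (coneAlgebra k s) f) : IsIntegral (coneAlgebra k s) (crossDeriv K i j f) := by
  let m : Polynomial (coneAlgebra k s) →ₐ[k] Polynomial (MvPolynomial (Fin 2) K) :=
    Polynomial.mapAlgHom (coneAlgebra k s).val
  have hm : Function.Injective m := Polynomial.map_injective _ Subtype.val_injective
  have hrange : coneAlgebra k s ≤ m.range.comap ((shear K i j).restrictScalars k) := by
    refine Algebra.adjoin_le ?_
    rintro _ ⟨a, ha, l, -, rfl⟩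
    refine ⟨Polynomial.C ⟨_, C_mul_X_mem_coneAlgebra ha l⟩ +
      if l = i then Polynomial.C ⟨_, C_mul_X_mem_coneAlgebra ha j⟩ * Polynomial.X else 0, ?_⟩
    by_cases h : l = i
    · simp [m, h, shear, mul_add, mul_assoc]
    · simp [m, h, shear]
  let φ : coneAlgebra k s →+* Polynomial (coneAlgebra k s) :=
    ((AlgEquiv.ofInjective m hm).symm.toAlgHom.comp
      ((((shear K i j).restrictScalars k).comp (coneAlgebra k s).val).codRestrict m.range
        fun x => hrange x.2)).toRingHom
  have hφ : ∀ x, m (φ x) = shear K i j x := fun x =>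
    congrArg Subtype.val ((AlgEquiv.ofInjective m hm).apply_symm_apply _)
  let := Polynomial.algebra (coneAlgebra k s) (MvPolynomial (Fin 2) K)
  have h : IsIntegral (Polynomial (coneAlgebra k s)) (shear K i j f) :=
    hf.map_of_comp_eq φ (shear K i j).toRingHom (by ext1 x; exact hφ x)
  have := h.coeff 1
  rwa [(shear_coeff i j f).2] at this

end ConeAlgebra

theorem exists_mem_LND_coe_eq {B : Type*} [CommRing B] (d : B → B)
    (hadd : ∀ a b, d (a + b) = d a + d b) (hmul : ∀ a b, d (a * b) = a * d b + b * d a)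
    (hnil : ∀ b, ∃ n : ℕ, d^[n] b = 0) : ∃ D ∈ LND B, ⇑D = d :=
  ⟨Derivation.mk' (AddMonoidHom.mk' d hadd).toIntLinearMap hmul, hnil, rfl⟩

/-! ### Fraction fields, kernels and the field lattice -/

section ConeFraction

open MvPolynomial

variable {k : Type u} {K : Type v} [Field k] [Field K] [Algebra k K]

/-- Divide aX_j by X_j. The subfield `T` is left general so as to serve both for Frac B and for the
fraction field of a kernel. -/
theorem algebraMap_mem_of_adjoin_eq_top {s : Set K} (hs : IntermediateField.adjoin k s = ⊤)
    (j : Fin 2) (T : Subfield (RatFunc₂ K)) (hk : ∀ c : k, algebraMap k (RatFunc₂ K) c ∈ T)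
    (hT : ∀ a ∈ insert 1 s, algebraMap (MvPolynomial (Fin 2) K) (RatFunc₂ K) (C a * X j) ∈ T)
    (a : K) : algebraMap K (RatFunc₂ K) a ∈ T := by
  have hC : ∀ a : K, algebraMap K (RatFunc₂ K) a =
      algebraMap (MvPolynomial (Fin 2) K) (RatFunc₂ K) (C a) :=
    fun a => IsScalarTower.algebraMap_apply _ _ _ a
  have hX : algebraMap (MvPolynomial (Fin 2) K) (RatFunc₂ K) (X j) ≠ 0 := by
    rw [Ne, map_eq_zero_iff _ (IsFractionRing.injective _ _)]
    exact X_ne_zero j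
  have ha : a ∈ IntermediateField.adjoin k s := hs ▸ IntermediateField.mem_top
  induction ha using IntermediateField.adjoin_induction with
  | mem a ha =>
    have h1 := hT 1 (Set.mem_insert _ _)
    have h2 := hT a (Set.mem_insert_of_mem _ ha)
    rw [C_1, one_mul] at h1
    rw [map_mul] at h2
    rw [hC, ← mul_div_cancel_right₀ (algebraMap _ (RatFunc₂ K) (C a)) hX]
    exact div_mem h2 h1
  | algebraMap c => rw [← IsScalarTower.algebraMap_apply]; exact hk c
  | add x y _ _ hx hy => rw [map_add]; exact add_mem hx hy
  | inv x _ hx => rw [map_inv₀]; exact inv_mem hx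
  | mul x y _ _ hx hy => rw [map_mul]; exact mul_mem hx hy

theorem exists_mem_coneAlgebra_eq_div {s : Set K} (hs : IntermediateField.adjoin k s = ⊤)
    (z : RatFunc₂ K) : ∃ x y : coneAlgebra k s,
      z = algebraMap (coneAlgebra k s) (RatFunc₂ K) x /
        algebraMap (coneAlgebra k s) (RatFunc₂ K) y := by
  let R : Subring (RatFunc₂ K) := (algebraMap (coneAlgebra k s) (RatFunc₂ K)).range
  have hcone : ∀ f ∈ coneAlgebra k s,
      algebraMap (MvPolynomial (Fin 2) K) (RatFunc₂ K) f ∈ Subfield.closure (R : Set _) :=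
    fun f hf => Subfield.subset_closure ⟨⟨f, hf⟩, rfl⟩
  have hK := algebraMap_mem_of_adjoin_eq_top hs 0 (Subfield.closure (R : Set (RatFunc₂ K)))
    (fun c => by
      rw [IsScalarTower.algebraMap_apply k (MvPolynomial (Fin 2) K)]
      exact hcone _ (algebraMap_mem _ c))
    fun a ha => hcone _ (C_mul_X_mem_coneAlgebra ha 0)
  have hP : ∀ f : MvPolynomial (Fin 2) K,
      algebraMap (MvPolynomial (Fin 2) K) (RatFunc₂ K) f ∈ Subfield.closure (R : Set _) := by
    intro f
    induction f using MvPolynomial.induction_on with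
    | C a =>
      rw [← MvPolynomial.algebraMap_eq, ← IsScalarTower.algebraMap_apply]
      exact hK a
    | add p q hp hq => rw [map_add]; exact add_mem hp hq
    | mul_X p i hp =>
      rw [map_mul]
      refine mul_mem hp (hcone _ ?_)
      simpa using C_mul_X_mem_coneAlgebra (k := k) (Set.mem_insert (1 : K) s) i
  have hz : z ∈ Subfield.closure (R : Set (RatFunc₂ K)) := by
    obtain ⟨x, y, -, rfl⟩ := IsFractionRing.div_surjective (A := MvPolynomial (Fin 2) K) z
    exact div_mem (hP x) (hP y)
  rw [Subfield.mem_closure_iff, Subring.closure_eq] at hz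
  obtain ⟨_, ⟨x, rfl⟩, _, ⟨y, rfl⟩, h⟩ := hz
  exact ⟨x, y, h.symm⟩

theorem injective_algebraMap_coneAlgebra (s : Set K) :
    Function.Injective (algebraMap (coneAlgebra k s) (RatFunc₂ K)) :=
  (IsFractionRing.injective (MvPolynomial (Fin 2) K) (RatFunc₂ K)).comp Subtype.val_injective

theorem isFractionRing_coneAlgebra {s : Set K} (hs : IntermediateField.adjoin k s = ⊤) :
    IsFractionRing (coneAlgebra k s) (RatFunc₂ K) :=
  have : FaithfulSMul (coneAlgebra k s) (RatFunc₂ K) :=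
    (faithfulSMul_iff_algebraMap_injective _ _).mpr (injective_algebraMap_coneAlgebra s)
  .of_field _ _ (exists_mem_coneAlgebra_eq_div hs)

/-- A subalgebra of `K(X 0, X 1)` between the cone algebra and `K[X 0, X 1]` that is stable under
the derivations `X j * ∂ / ∂ X i`. -/
structure IsConeLike (s : Set K) (B : Subalgebra k (RatFunc₂ K)) : Prop where
  exists_eq : ∀ b ∈ B, ∃ f : MvPolynomial (Fin 2) K, algebraMap _ (RatFunc₂ K) f = b
  crossDeriv_mem : ∀ (i j : Fin 2) (f : MvPolynomial (Fin 2) K),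
    algebraMap _ (RatFunc₂ K) f ∈ B → algebraMap _ (RatFunc₂ K) (crossDeriv K i j f) ∈ B
  cone_mem : ∀ f ∈ coneAlgebra k s, algebraMap _ (RatFunc₂ K) f ∈ B

namespace IsConeLike

variable {s : Set K} {B : Subalgebra k (RatFunc₂ K)}

theorem isFractionRing (hB : IsConeLike s B) (hs : IntermediateField.adjoin k s = ⊤) :
    IsFractionRing B (RatFunc₂ K) :=
  .of_field _ _ fun z => by
    obtain ⟨x, y, h⟩ := exists_mem_coneAlgebra_eq_div hs z
    exact ⟨⟨_, hB.cone_mem x x.2⟩, ⟨_, hB.cone_mem y y.2⟩, h⟩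

theorem exists_mem_LND (hB : IsConeLike s B) {i j : Fin 2} (hij : i ≠ j) :
    ∃ D ∈ LND B, ∀ (b : B) (f : MvPolynomial (Fin 2) K), algebraMap _ (RatFunc₂ K) f = b →
      (D b : RatFunc₂ K) = algebraMap _ (RatFunc₂ K) (crossDeriv K i j f) := by
  -- The polynomial lift is unique, so any lift computes `d`; additivity and the Leibniz rule are
  -- then inherited.
  choose ℓ hℓ using fun b : B => hB.exists_eq b b.2
  have hinj := IsFractionRing.injective (MvPolynomial (Fin 2) K) (RatFunc₂ K)
  let d : B → B := fun b => ⟨_, hB.crossDeriv_mem i j (ℓ b) (by rw [hℓ]; exact b.2)⟩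
  have hd : ∀ (b : B) (f : MvPolynomial (Fin 2) K), algebraMap _ (RatFunc₂ K) f = b →
      (d b : RatFunc₂ K) = algebraMap _ (RatFunc₂ K) (crossDeriv K i j f) := by
    intro b f hf
    rw [← hinj ((hℓ b).trans hf.symm)]
  have h : ∀ (n : ℕ) (b : B) (f : MvPolynomial (Fin 2) K), algebraMap _ (RatFunc₂ K) f = b →
      ((d^[n] b : B) : RatFunc₂ K) = algebraMap _ (RatFunc₂ K) ((⇑(crossDeriv K i j))^[n] f) := by
    intro n
    induction n with
    | zero => exact fun b f hf => hf.symm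
    | succ n ih => exact fun b f hf => ih _ _ (hd b f hf).symm
  obtain ⟨D, hD, hDd⟩ := exists_mem_LND_coe_eq d
    (fun a b => Subtype.ext <| by
      rw [hd (a + b) (ℓ a + ℓ b) (by simp [hℓ])]
      simp [d])
    (fun a b => Subtype.ext <| by
      rw [hd (a * b) (ℓ a * ℓ b) (by simp [hℓ])]
      simp [d, hℓ])
    fun b => by
      obtain ⟨n, hn⟩ := exists_iterate_crossDeriv_eq_zero hij (ℓ b)
      exact ⟨n, Subtype.ext (by rw [h n b (ℓ b) (hℓ b), hn, map_zero]; rfl)⟩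
  exact ⟨D, hD, hDd ▸ hd⟩

theorem exists_eq_algebraMap_of_mem_makarLimanov [CharZero K] (hB : IsConeLike s B) {b : B}
    (hb : b ∈ makarLimanov B) : ∃ a : K, (b : RatFunc₂ K) = algebraMap K (RatFunc₂ K) a := by
  obtain ⟨f, hf⟩ := hB.exists_eq b b.2
  have hinj := IsFractionRing.injective (MvPolynomial (Fin 2) K) (RatFunc₂ K)
  rw [mem_makarLimanov] at hb
  have hv : ∀ i j : Fin 2, i ≠ j → i ∉ f.vars := by
    intro i j hij
    obtain ⟨D, hD, hD'⟩ := hB.exists_mem_LND hij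
    have h := hD' b f hf
    rw [hb D hD] at h
    exact notMem_vars_of_pderiv_eq_zero (crossDeriv_eq_zero_iff.mp (hinj (by rw [← h]; simp)))
  have hfC : f = C (constantCoeff f) := by
    refine hom_congr_vars (f₁ := RingHom.id _) (f₂ := C.comp constantCoeff) (p₁ := f) (p₂ := f)
      (by ext; simp) (fun i hi => ?_) rfl
    fin_cases i
    · exact absurd hi (hv 0 1 (by decide))
    · exact absurd hi (hv 1 0 (by decide))
  refine ⟨constantCoeff f, ?_⟩
  rw [← hf, IsScalarTower.algebraMap_apply K (MvPolynomial (Fin 2) K), MvPolynomial.algebraMap_eq,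
    ← hfC]

theorem exists_eq_div_of_mem_fracIn {D} (_ : D ∈ LND B) {z : RatFunc₂ K}
    (hz : z ∈ fracIn (RatFunc₂ K) (derivationKer D)) :
    ∃ x y : B, D x = 0 ∧ D y = 0 ∧ z = x / y := by
  have : algebraMap B (RatFunc₂ K) '' (derivationKer D : Set B) =
      ((derivationKer D).map (algebraMap B (RatFunc₂ K)) : Set (RatFunc₂ K)) := rfl
  rw [fracIn, this, Subfield.mem_closure_iff, Subring.closure_eq] at hz
  obtain ⟨_, ⟨x, hx, rfl⟩, _, ⟨y, hy, rfl⟩, h⟩ := hz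
  exact ⟨x, y, hx, hy, h.symm⟩

theorem fieldRange_mem_fieldLattice [CharZero K] (hB : IsConeLike s B)
    (hs : IntermediateField.adjoin k s = ⊤) [IsFractionRing B (RatFunc₂ K)] :
    (algebraMap K (RatFunc₂ K)).fieldRange ∈ fieldLattice B (RatFunc₂ K) := by
  have hinj := IsFractionRing.injective (MvPolynomial (Fin 2) K) (RatFunc₂ K)
  obtain ⟨D₀, hD₀, hD₀'⟩ := hB.exists_mem_LND (i := 0) (j := 1) (by decide)
  obtain ⟨D₁, hD₁, hD₁'⟩ := hB.exists_mem_LND (i := 1) (j := 0) (by decide)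
  refine ⟨{D₀, D₁}, by rintro _ (rfl | rfl) <;> assumption, ?_⟩
  rw [fracKerInter, iInf_pair]
  apply le_antisymm
  · have key : ∀ (i j : Fin 2) (D) (_ : D ∈ LND B), i ≠ j →
        (∀ (b : B) (f : MvPolynomial (Fin 2) K), algebraMap _ (RatFunc₂ K) f = b →
          (D b : RatFunc₂ K) = algebraMap _ (RatFunc₂ K) (crossDeriv K i j f)) →
        ∀ a : K, algebraMap K (RatFunc₂ K) a ∈ fracIn (RatFunc₂ K) (derivationKer D) := by
      intro i j D _ hij hD
      have hmem : ∀ f : MvPolynomial (Fin 2) K, f ∈ coneAlgebra k s → crossDeriv K i j f = 0 →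
          algebraMap _ (RatFunc₂ K) f ∈ fracIn (RatFunc₂ K) (derivationKer D) := by
        intro f hf hf0
        refine Subfield.subset_closure ⟨⟨_, hB.cone_mem f hf⟩, Subtype.ext ?_, rfl⟩
        rw [hD _ f rfl, hf0, map_zero]
        rfl
      refine algebraMap_mem_of_adjoin_eq_top hs j _ (fun c => ?_) fun a ha => ?_
      · rw [IsScalarTower.algebraMap_apply k (MvPolynomial (Fin 2) K)]
        refine hmem _ (algebraMap_mem _ c) ?_
        rw [IsScalarTower.algebraMap_apply k K, Derivation.map_algebraMap]
      · refine hmem _ (C_mul_X_mem_coneAlgebra ha j) ?_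
        rw [← smul_eq_C_mul, Derivation.map_smul, crossDeriv_X_of_ne hij.symm, smul_zero]
    rintro _ ⟨a, rfl⟩
    exact ⟨key 0 1 D₀ hD₀ (by decide) hD₀' a, key 1 0 D₁ hD₁ (by decide) hD₁' a⟩
  · rintro z ⟨hz₀, hz₁⟩
    have key : ∀ (i j : Fin 2) (D) (_ : D ∈ LND B),
        (∀ (b : B) (f : MvPolynomial (Fin 2) K), algebraMap _ (RatFunc₂ K) f = b →
          (D b : RatFunc₂ K) = algebraMap _ (RatFunc₂ K) (crossDeriv K i j f)) →
        z ∈ fracIn (RatFunc₂ K) (derivationKer D) →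
        ∃ f g : MvPolynomial (Fin 2) K, i ∉ f.vars ∧ i ∉ g.vars ∧
          z = algebraMap _ (RatFunc₂ K) f / algebraMap _ (RatFunc₂ K) g := by
      intro i j D hLND hD hz
      obtain ⟨x, y, hx, hy, h⟩ := exists_eq_div_of_mem_fracIn hLND hz
      obtain ⟨f, hf⟩ := hB.exists_eq x x.2
      obtain ⟨g, hg⟩ := hB.exists_eq y y.2
      have hf' := hD x f hf
      have hg' := hD y g hg
      rw [hx] at hf'
      rw [hy] at hg'
      exact ⟨f, g,
        notMem_vars_of_pderiv_eq_zero (crossDeriv_eq_zero_iff.mp (hinj (by rw [← hf']; simp))),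
        notMem_vars_of_pderiv_eq_zero (crossDeriv_eq_zero_iff.mp (hinj (by rw [← hg']; simp))),
        by rw [hf, hg, h]⟩
    obtain ⟨f₁, g₁, hf₁, hg₁, h₁⟩ := key 0 1 D₀ hD₀ hD₀' hz₀
    obtain ⟨f₂, g₂, hf₂, hg₂, h₂⟩ := key 1 0 D₁ hD₁ hD₁' hz₁
    -- The denominators found so far may vanish, in which case z = 0 by the convention x / 0 = 0.
    rcases eq_or_ne z 0 with rfl | hz
    · exact zero_mem _
    have hg₁0 : algebraMap _ (RatFunc₂ K) g₁ ≠ 0 := by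
      intro h; rw [h, div_zero] at h₁; exact hz h₁
    have hg₂0 : algebraMap _ (RatFunc₂ K) g₂ ≠ 0 := by
      intro h; rw [h, div_zero] at h₂; exact hz h₂
    have hcross : f₁ * g₂ = f₂ * g₁ := by
      apply hinj
      rw [map_mul, map_mul, ← div_eq_div_iff hg₁0 hg₂0, ← h₁, ← h₂]
    obtain ⟨p, hp⟩ : ∃ p : Fin 2 → K, eval p g₂ ≠ 0 := by
      by_contra! h
      have h0 : g₂ = 0 := MvPolynomial.funext (by simpa using h)
      exact hg₂0 (by rw [h0, map_zero])
    -- Now z is a fraction in X_1 alone and also one in X_0 alone. Specializing X_0 where `g₂` does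
    -- not vanish fixes the first and makes the second a constant.
    let e : MvPolynomial (Fin 2) K →ₐ[K] MvPolynomial (Fin 2) K :=
      aeval (Function.update X 0 (C (p 0)))
    have he₁ : ∀ f : MvPolynomial (Fin 2) K, (0 : Fin 2) ∉ f.vars → e f = f := by
      intro f hf
      refine hom_congr_vars (f₁ := e.toRingHom) (f₂ := RingHom.id _) (p₁ := f) (p₂ := f)
        (by ext; simp [e]) (fun i hi _ => ?_) rfl
      have : i ≠ 0 := fun h => hf (h ▸ hi)
      simp [e, this]
    have he₂ : ∀ f : MvPolynomial (Fin 2) K, (1 : Fin 2) ∉ f.vars → e f = C (eval p f) := by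
      intro f hf
      refine hom_congr_vars (f₁ := e.toRingHom) (f₂ := C.comp (eval p)) (p₁ := f) (p₂ := f)
        (by ext; simp [e]) (fun i hi _ => ?_) rfl
      obtain rfl : i = 0 := by
        fin_cases i
        · rfl
        · exact absurd hi hf
      simp [e]
    have h := congrArg (algebraMap _ (RatFunc₂ K)) (congrArg e hcross)
    rw [map_mul e, map_mul e, he₁ _ hf₁, he₁ _ hg₁, he₂ _ hf₂, he₂ _ hg₂, map_mul, map_mul,
      ← MvPolynomial.algebraMap_eq, ← IsScalarTower.algebraMap_apply,
      ← IsScalarTower.algebraMap_apply] at h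
    refine ⟨eval p f₂ / eval p g₂, ?_⟩
    rw [map_div₀, h₁, eq_comm, div_eq_div_iff hg₁0, h]
    rwa [Ne, map_eq_zero_iff _ (algebraMap K (RatFunc₂ K)).injective]

end IsConeLike

end ConeFraction

/-! ### The cone algebra and its normalization -/

section Cones

open MvPolynomial

variable {k : Type u} {K : Type v} [Field k] [Field K] [Algebra k K]

theorem isConeLike_map_coneAlgebra (s : Set K) :
    IsConeLike s ((coneAlgebra k s).map
      (IsScalarTower.toAlgHom k (MvPolynomial (Fin 2) K) (RatFunc₂ K))) where
  exists_eq := by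
    rintro _ ⟨f, -, rfl⟩
    exact ⟨f, rfl⟩
  crossDeriv_mem := by
    rintro i j f ⟨g, hg, hgf⟩
    obtain rfl : g = f := IsFractionRing.injective (MvPolynomial (Fin 2) K) (RatFunc₂ K) hgf
    exact ⟨_, crossDeriv_mem_coneAlgebra i j hg, rfl⟩
  cone_mem := fun f hf => ⟨f, hf, rfl⟩

/-- The integral closure of the cone algebra in `K(X 0, X 1)`. -/
noncomputable def normalCone (k : Type u) {K : Type v} [Field k] [Field K] [Algebra k K]
    (s : Set K) : Subalgebra k (RatFunc₂ K) :=
  (integralClosure (coneAlgebra k s) (RatFunc₂ K)).restrictScalars k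

theorem mem_normalCone {s : Set K} {z : RatFunc₂ K} :
    z ∈ normalCone k s ↔ IsIntegral (coneAlgebra k s) z := Iff.rfl

theorem algebraMap_mem_normalCone {s : Set K} {f : MvPolynomial (Fin 2) K} :
    algebraMap _ (RatFunc₂ K) f ∈ normalCone k s ↔ IsIntegral (coneAlgebra k s) f :=
  isIntegral_algebraMap_iff (IsFractionRing.injective _ _)

theorem isConeLike_normalCone (s : Set K) : IsConeLike s (normalCone k s) where
  exists_eq := fun _ hb =>
    (IsIntegrallyClosed.isIntegral_iff (R := MvPolynomial (Fin 2) K)).mp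
      (IsIntegral.tower_top (mem_normalCone.mp hb))
  crossDeriv_mem := fun i j _ hf =>
    algebraMap_mem_normalCone.mpr (isIntegral_crossDeriv i j (algebraMap_mem_normalCone.mp hf))
  cone_mem := fun f hf =>
    algebraMap_mem_normalCone.mpr (isIntegral_algebraMap (x := (⟨f, hf⟩ : coneAlgebra k s)))

theorem isIntegrallyClosed_normalCone {s : Set K} (hs : IntermediateField.adjoin k s = ⊤) :
    IsIntegrallyClosed (normalCone k s) := by
  have := (isConeLike_normalCone (k := k) s).isFractionRing hs
  rw [isIntegrallyClosed_iff_isIntegrallyClosedIn (RatFunc₂ K)]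
  exact inferInstanceAs
    (IsIntegrallyClosedIn (integralClosure (coneAlgebra k s) (RatFunc₂ K)) (RatFunc₂ K))

theorem finiteType_normalCone [CharZero k] {s : Set K} (hfin : s.Finite)
    (hs : IntermediateField.adjoin k s = ⊤) : Algebra.FiniteType k (normalCone k s) :=
  have := isFractionRing_coneAlgebra hs
  have := finiteType_coneAlgebra (k := k) hfin
  finiteType_integralClosure k (coneAlgebra k s) (RatFunc₂ K)

/-- Invariants are constants integral over the cone algebra, hence algebraic over k. Conversely, the
algebraic closure of k in K is a field inside the normal cone, so its nonzero elements are units. -/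
theorem map_makarLimanov_normalCone [CharZero k] (s : Set K) :
    (makarLimanov (normalCone k s)).map (algebraMap (normalCone k s) (RatFunc₂ K)) =
      (algebraicClosure k K).toSubalgebra.toSubring.map (algebraMap K (RatFunc₂ K)) := by
  have : CharZero K := charZero_of_injective_algebraMap (algebraMap k K).injective
  have hK : ∀ a : K, algebraMap K (RatFunc₂ K) a = algebraMap _ (RatFunc₂ K) (C a) :=
    fun a => IsScalarTower.algebraMap_apply _ (MvPolynomial (Fin 2) K) _ a
  apply le_antisymm
  · rintro _ ⟨b, hb, rfl⟩
    obtain ⟨a, ha⟩ := (isConeLike_normalCone s).exists_eq_algebraMap_of_mem_makarLimanov hb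
    refine ⟨a, ?_, ha.symm⟩
    have hb' := b.2
    rw [ha, hK, algebraMap_mem_normalCone] at hb'
    exact mem_algebraicClosure_iff'.mpr (isIntegral_of_isIntegral_C hb')
  · rintro _ ⟨a, ha, rfl⟩
    have hmem : ∀ a ∈ algebraicClosure k K, algebraMap K (RatFunc₂ K) a ∈ normalCone k s := by
      intro a ha
      have : IsIntegral k (algebraMap K (RatFunc₂ K) a) :=
        (mem_algebraicClosure_iff'.mp ha).map (IsScalarTower.toAlgHom k K (RatFunc₂ K))
      exact this.tower_top
    refine ⟨⟨_, hmem a ha⟩, ?_, rfl⟩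
    rcases eq_or_ne a 0 with rfl | h0
    · have h : (⟨_, hmem 0 ha⟩ : normalCone k s) = 0 := Subtype.ext (map_zero _)
      rw [h]
      exact zero_mem (makarLimanov (normalCone k s))
    · refine mem_makarLimanov.mpr fun D hD => ?_
      refine apply_eq_zero_of_mul_eq_one hD (b := ⟨_, hmem a⁻¹ (inv_mem ha)⟩) (Subtype.ext ?_)
      change algebraMap K (RatFunc₂ K) a * algebraMap K (RatFunc₂ K) a⁻¹ = 1
      rw [← map_mul, mul_inv_cancel₀ h0, map_one]

theorem makarLimanov_map_coneAlgebra [CharZero k] (s : Set K) :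
    makarLimanov ((coneAlgebra k s).map
      (IsScalarTower.toAlgHom k (MvPolynomial (Fin 2) K) (RatFunc₂ K))) =
      (algebraMap k ((coneAlgebra k s).map
        (IsScalarTower.toAlgHom k (MvPolynomial (Fin 2) K) (RatFunc₂ K)))).range := by
  have : CharZero K := charZero_of_injective_algebraMap (algebraMap k K).injective
  have : CharZero (RatFunc₂ K) := charZero_of_injective_algebraMap (algebraMap k _).injective
  apply le_antisymm
  · intro b hb
    obtain ⟨a, ha⟩ := (isConeLike_map_coneAlgebra s).exists_eq_algebraMap_of_mem_makarLimanov hb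
    obtain ⟨f, hf, hfb⟩ := b.2
    have hfa : f = C a := by
      apply IsFractionRing.injective (MvPolynomial (Fin 2) K) (RatFunc₂ K)
      rw [← MvPolynomial.algebraMap_eq, ← IsScalarTower.algebraMap_apply, ← ha]
      exact hfb
    obtain ⟨c, hc⟩ := constantCoeff_mem_of_mem_coneAlgebra hf
    refine ⟨c, Subtype.ext ?_⟩
    rw [ha]
    rw [hfa, constantCoeff_C] at hc
    rw [← hc, ← IsScalarTower.algebraMap_apply]
    rfl
  · exact algebraMap_range_le_makarLimanov k

end Cones

/-! ### Dimension and transcendence degree -/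

theorem exists_ringKrullDim_eq_trdeg (k : Type u) (A : Type v) [Field k] [CommRing A] [IsDomain A]
    [Algebra k A] [Algebra.FiniteType k A] :
    ∃ n : ℕ, ringKrullDim A = n ∧ Algebra.trdeg k A = n := by
  obtain ⟨n, g, hg, hint⟩ := exists_integral_inj_algHom_of_fg k A
  let : Algebra (MvPolynomial (Fin n) k) A := g.toRingHom.toAlgebra
  have : IsScalarTower k (MvPolynomial (Fin n) k) A := .of_algHom g
  have : Algebra.IsIntegral (MvPolynomial (Fin n) k) A := ⟨hint⟩
  have : FaithfulSMul (MvPolynomial (Fin n) k) A :=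
    (faithfulSMul_iff_algebraMap_injective _ _).mpr hg
  refine ⟨n, ?_, ?_⟩
  · rw [ringKrullDim_eq_of_isIntegral (MvPolynomial (Fin n) k) A,
      MvPolynomial.ringKrullDim_of_isNoetherianRing, ringKrullDim_eq_zero_of_field]
    simp
  · have h := lift_trdeg_add_eq k (MvPolynomial (Fin n) k) A
    rw [trdeg_eq_zero (R := MvPolynomial (Fin n) k) (A := A), MvPolynomial.trdeg_of_isDomain] at h
    rw [← Cardinal.lift_inj.{v, u}, ← h]
    simp

theorem trdeg_eq_of_isFractionRing (k : Type u) (A L : Type v) [Field k] [CommRing A] [IsDomain A]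
    [Field L] [Algebra k A] [Algebra A L] [Algebra k L] [IsScalarTower k A L]
    [IsFractionRing A L] : Algebra.trdeg k L = Algebra.trdeg k A := by
  have : FaithfulSMul k A := (faithfulSMul_iff_algebraMap_injective _ _).mpr
    (algebraMap k A).injective
  have : FaithfulSMul A L := (faithfulSMul_iff_algebraMap_injective _ _).mpr
    (IsFractionRing.injective A L)
  have : Algebra.IsAlgebraic A L := IsLocalization.isAlgebraic L (nonZeroDivisors A)
  rw [← trdeg_add_eq k A (A := L), trdeg_eq_zero (R := A), add_zero]

theorem trdeg_ratFunc₂ (k : Type u) (K : Type v) [Field k] [Field K] [Algebra k K] :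
    Algebra.trdeg k (RatFunc₂ K) = Algebra.trdeg k K + 2 := by
  rw [← trdeg_add_eq k K (A := RatFunc₂ K),
    trdeg_eq_of_isFractionRing K (MvPolynomial (Fin 2) K) (RatFunc₂ K)]
  simp

/-! ### Points of 2z³ = 1 + w³ in purely transcendental extensions -/

section Curve

theorem RatFunc.exists_eq_C_of_two_mul_pow_three {E : Type*} [Field E] [CharZero E]
    {z w : RatFunc E} (h : 2 * z ^ 3 = 1 + w ^ 3) : ∃ e, z = RatFunc.C e := by
  let ι := algebraMap (Polynomial E) (RatFunc E)
  have hinj : Function.Injective ι := IsFractionRing.injective _ _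
  set a := z.num
  set c := z.denom
  have hc : c ≠ 0 := z.denom_ne_zero
  have hιc : ι c ≠ 0 := (map_ne_zero_iff ι hinj).mpr hc
  have hz : z = ι a / ι c := z.num_div_denom.symm
  rcases eq_or_ne a 0 with ha | ha
  · exact ⟨0, by rw [hz, ha, map_zero, zero_div, map_zero]⟩
  have hcop : IsCoprime a c := z.isCoprime_num_denom
  have hcz : ι c * z = ι a := by rw [hz, mul_div_cancel₀ _ hιc]
  have hpow : (ι c * w) ^ 3 = ι (2 * a ^ 3 - c ^ 3) := by
    rw [map_sub, map_mul, map_pow, map_pow, ← hcz, map_ofNat]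
    linear_combination -(ι c) ^ 3 * h
  -- The cube of cw is a polynomial and E[X] is integrally closed, so w has the same denominator as
  -- z.
  obtain ⟨b, hb⟩ : ∃ b, ι b = ι c * w := by
    refine (IsIntegrallyClosed.isIntegral_iff (R := Polynomial E)).mp ?_
    refine .of_pow (n := 3) (by norm_num) ?_
    rw [hpow]
    exact isIntegral_algebraMap
  have hb3 : b ^ 3 = 2 * a ^ 3 - c ^ 3 := hinj (by rw [map_pow, hb, hpow])
  have hdeg : a.natDegree = 0 ∧ c.natDegree = 0 := by
    rcases eq_or_ne b 0 with rfl | hb0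
    · have h3 : c ^ 3 = 2 * a ^ 3 := by linear_combination hb3
      have hcop3 : IsCoprime (a ^ 3) (c ^ 3) := hcop.pow
      have ha3 : IsUnit (a ^ 3) := hcop3.isUnit_of_dvd' dvd_rfl (h3 ▸ Dvd.intro_left _ rfl)
      have hau : IsUnit a := (isUnit_pow_iff three_ne_zero).mp ha3
      have h2 : IsUnit (2 : Polynomial E) := by
        rw [← map_ofNat Polynomial.C 2, Polynomial.isUnit_C]
        simp
      have hcu : IsUnit c := (isUnit_pow_iff three_ne_zero).mp (h3 ▸ h2.mul ha3)
      exact ⟨Polynomial.natDegree_eq_zero_of_isUnit hau,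
        Polynomial.natDegree_eq_zero_of_isUnit hcu⟩
    -- Mason–Stothers for 2a³ - c³ - b³ = 0, in the boundary case 1/3 + 1/3 + 1/3 = 1.
    · have := Polynomial.flt_catalan (p := 3) (q := 3) (r := 3) (by norm_num) (by norm_num)
        (by norm_num) (by norm_num) (by norm_num) (by norm_num) (by norm_num) ha hc hb0 hcop
        (u := (2 : E)) (v := -1) (w := -1) (by norm_num) (by norm_num) (by norm_num)
        (by rw [hb3]; simp only [map_neg, map_one, map_ofNat]; ring)
      exact ⟨this.1, this.2.1⟩
  refine ⟨a.coeff 0 / c.coeff 0, ?_⟩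
  rw [hz, Polynomial.eq_C_of_natDegree_eq_zero hdeg.1, Polynomial.eq_C_of_natDegree_eq_zero hdeg.2]
  simp [ι]

theorem RatFunc.exists_eq_C_and_eq_C_of_two_mul_pow_three {E : Type*} [Field E] [CharZero E]
    {z w : RatFunc E} (h : 2 * z ^ 3 = 1 + w ^ 3) :
    (∃ e, z = RatFunc.C e) ∧ ∃ e, w = RatFunc.C e := by
  obtain ⟨e, rfl⟩ := RatFunc.exists_eq_C_of_two_mul_pow_three h
  refine ⟨⟨e, rfl⟩, not_not.mp fun hw => RatFunc.transcendental_of_ne_C w hw ?_⟩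
  have hw3 : w ^ 3 = algebraMap E (RatFunc E) (2 * e ^ 3 - 1) := by
    rw [RatFunc.algebraMap_eq_C, map_sub, map_mul, map_pow, map_one, map_ofNat, h]
    ring
  exact (IsIntegral.of_pow (n := 3) (by norm_num) (hw3 ▸ isIntegral_algebraMap)).isAlgebraic

open IntermediateField

theorem mem_of_two_mul_pow_three_of_transcendental {E F : Type*} [Field E] [CharZero E] [Field F]
    [Algebra E F] {t : F} (ht : Transcendental E t) {z w : F} (hz : z ∈ E⟮t⟯) (hw : w ∈ E⟮t⟯)
    (h : 2 * z ^ 3 = 1 + w ^ 3) : z ∈ (algebraMap E F).range ∧ w ∈ (algebraMap E F).range := by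
  let e := RatFunc.algEquivOfTranscendental t ht
  have h' : 2 * (e.symm ⟨z, hz⟩) ^ 3 = 1 + (e.symm ⟨w, hw⟩) ^ 3 := by
    have h' : 2 * (⟨z, hz⟩ : E⟮t⟯) ^ 3 = 1 + (⟨w, hw⟩ : E⟮t⟯) ^ 3 := Subtype.ext h
    have h'' := congrArg e.symm h'
    rwa [map_mul, map_add, map_pow, map_pow, map_one, map_ofNat] at h''
  have key : ∀ (x : F) (hx : x ∈ E⟮t⟯), (∃ c, e.symm ⟨x, hx⟩ = RatFunc.C c) →
      x ∈ (algebraMap E F).range := by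
    rintro x hx ⟨c, hc⟩
    refine ⟨c, ?_⟩
    rw [AlgEquiv.symm_apply_eq, ← RatFunc.algebraMap_eq_C, AlgEquiv.commutes] at hc
    exact (congrArg Subtype.val hc).symm
  obtain ⟨h₁, h₂⟩ := RatFunc.exists_eq_C_and_eq_C_of_two_mul_pow_three h'
  exact ⟨key z hz h₁, key w hw h₂⟩

theorem IsPurelyTranscendental.mem_range_of_two_mul_pow_three {k F : Type*} [Field k] [CharZero k] [Field F]
    [Algebra k F] (hF : IsPurelyTranscendental k F) {z w : F} (h : 2 * z ^ 3 = 1 + w ^ 3) :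
    z ∈ (algebraMap k F).range := by
  classical
  obtain ⟨s, hs, htop⟩ := hF
  -- Only finitely many variables occur, and they are removed one at a time; both coordinates must
  -- descend for the induction to continue.
  have key : ∀ (T : Finset F), (T : Set F) ⊆ s → ∀ z w : F, z ∈ adjoin k (T : Set F) →
      w ∈ adjoin k (T : Set F) → 2 * z ^ 3 = 1 + w ^ 3 → z ∈ (algebraMap k F).range := by
    intro T
    induction T using Finset.induction_on with
    | empty =>
      intro _ z w hz _ _
      rw [Finset.coe_empty, adjoin_empty] at hz
      exact mem_bot.mp hz
    | insert t T ht ih =>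
      intro hT z w hz hw h
      rw [Finset.coe_insert, Set.insert_subset_iff] at hT
      rw [Finset.coe_insert, Set.insert_eq, Set.union_comm, ← adjoin_adjoin_left] at hz hw
      have htr : Transcendental (adjoin k (T : Set F)) t := by
        rw [transcendental_adjoin_iff]
        have := hs.transcendental_adjoin (s := Subtype.val ⁻¹' (T : Set F)) (i := ⟨t, hT.1⟩)
          (by simpa using ht)
        rwa [Subtype.image_preimage_coe, Set.inter_eq_right.mpr hT.2] at this
      have : CharZero (adjoin k (T : Set F)) :=
        charZero_of_injective_algebraMap (algebraMap k _).injective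
      obtain ⟨⟨z', rfl⟩, ⟨w', rfl⟩⟩ := mem_of_two_mul_pow_three_of_transcendental htr hz hw h
      exact ih hT.2 _ _ z'.2 w'.2 h
  obtain ⟨T₁, hT₁, hz⟩ := exists_finset_of_mem_adjoin (htop ▸ mem_top : z ∈ adjoin k s)
  obtain ⟨T₂, hT₂, hw⟩ := exists_finset_of_mem_adjoin (htop ▸ mem_top : w ∈ adjoin k s)
  exact key (T₁ ∪ T₂) (by simp [hT₁, hT₂]) z w
    (adjoin.mono _ _ _ (by simp) hz) (adjoin.mono _ _ _ (by simp) hw) h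

end Curve

/-! ### The function field of the cubic inside Frac k⟦X⟧ -/

section PowerSeriesCurve

open PowerSeries IntermediateField

/-- Such an element is a power series p, and p - p(0) is algebraic over k. If nonzero it would be a
unit, but its constant coefficient is 0. -/
theorem mem_range_of_isIntegral_fractionRing_powerSeries {k : Type*} [Field k]
    {α : FractionRing k⟦X⟧} (h : IsIntegral k α) :
    α ∈ (algebraMap k (FractionRing k⟦X⟧)).range := by
  obtain ⟨p, rfl⟩ := (IsIntegrallyClosed.isIntegral_iff (R := k⟦X⟧)).mp (h.tower_top (A := k⟦X⟧))
  have hp : IsIntegral k p := (isIntegral_algebraMap_iff (IsFractionRing.injective _ _)).mp h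
  refine ⟨constantCoeff p, ?_⟩
  rw [IsScalarTower.algebraMap_apply k k⟦X⟧]
  congr 1
  by_contra hne
  have hu := (hp.sub (isIntegral_algebraMap (x := constantCoeff p))).isUnit
    (sub_ne_zero.mpr (Ne.symm hne))
  rw [isUnit_iff_constantCoeff, map_sub, PowerSeries.algebraMap_apply] at hu
  simp at hu

/-- The cube root of `1 + X` in `k⟦X⟧` with constant coefficient `1`. -/
noncomputable def cubeRoot (k : Type*) [Field k] [CharZero k] : k⟦X⟧ :=
  binomialSeries k (3⁻¹ : ℚ)

theorem cubeRoot_pow_three (k : Type*) [Field k] [CharZero k] :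
    cubeRoot k ^ 3 = 1 + X := by
  have h : binomialSeries k (3⁻¹ + 3⁻¹ + 3⁻¹ : ℚ) = 1 + X := by
    have := binomialSeries_nat (R := ℚ) (A := k) 1
    rwa [Nat.cast_one, pow_one, show (1 : ℚ) = 3⁻¹ + 3⁻¹ + 3⁻¹ by norm_num] at this
  rw [binomialSeries_add, binomialSeries_add] at h
  rw [← h, cubeRoot]
  ring

/-- Expansion at the point (1, 1): z³ = 1 + X and w³ = 1 + 2X. -/
theorem exists_powerSeries_two_mul_pow_three (k : Type*) [Field k] [CharZero k] :
    ∃ z w : k⟦X⟧, z ^ 3 = 1 + X ∧ 2 * z ^ 3 = 1 + w ^ 3 := by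
  refine ⟨cubeRoot k, rescale 2 (cubeRoot k), cubeRoot_pow_three k, ?_⟩
  rw [← map_pow, cubeRoot_pow_three, map_add, map_one, rescale_X, map_ofNat]
  ring

theorem exists_functionField_two_mul_pow_three (k : Type u) [Field k] [CharZero k] :
    ∃ (K : Type u) (_ : Field K) (_ : Algebra k K), (⊤ : IntermediateField k K).FG ∧
      algebraicClosure k K = ⊥ ∧ Algebra.trdeg k K = 1 ∧
      ∃ z w : K, 2 * z ^ 3 = 1 + w ^ 3 ∧ z ∉ (algebraMap k K).range := by
  obtain ⟨z, w, hz, hzw⟩ := exists_powerSeries_two_mul_pow_three k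
  let F := FractionRing k⟦X⟧
  let ι : k⟦X⟧ →+* F := algebraMap k⟦X⟧ F
  let E : IntermediateField k F := adjoin k {ι z, ι w}
  let z' : E := ⟨ι z, subset_adjoin _ _ (by simp)⟩
  let w' : E := ⟨ι w, subset_adjoin _ _ (by simp)⟩
  have htop : adjoin k {z', w'} = ⊤ := by
    apply lift_injective
    rw [lift_adjoin, lift_top, Set.image_pair]
  have hzw' : 2 * z' ^ 3 = 1 + w' ^ 3 := Subtype.ext <| by
    have h := congrArg ι hzw
    rwa [map_mul, map_add, map_pow, map_pow, map_one, map_ofNat] at h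
  have hclosed : ∀ a : E, IsIntegral k a → a ∈ (algebraMap k E).range := by
    intro a ha
    obtain ⟨c, hc⟩ := mem_range_of_isIntegral_fractionRing_powerSeries (ha.map E.val)
    exact ⟨c, Subtype.ext hc⟩
  have hz' : z' ∉ (algebraMap k E).range := by
    rintro ⟨c, hc⟩
    have h1 : ι z = ι (PowerSeries.C c) := by
      rw [← show (z' : F) = ι z from rfl, ← hc]
      rfl
    have h2 : z = PowerSeries.C c := IsFractionRing.injective k⟦X⟧ F h1
    rw [h2, ← map_pow] at hz
    have := congrArg (coeff 1) hz
    rw [coeff_C, map_add, coeff_one, coeff_one_X] at this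
    simp at this
  refine ⟨E, inferInstance, inferInstance, ?_, ?_, ?_, z', w', hzw', hz'⟩
  · rw [← htop]
    exact fg_adjoin_of_finite (by simp)
  · rw [eq_bot_iff]
    intro a ha
    exact mem_bot.mpr (hclosed a (mem_algebraicClosure_iff'.mp ha))
  · apply le_antisymm
    · have : Algebra.IsAlgebraic (Algebra.adjoin k {z'}) E := by
        rw [← isAlgebraic_adjoin_iff_top]
        have hw : IsIntegral (adjoin k {z'}) w' := by
          refine .of_pow (n := 3) (by norm_num) ?_
          have : w' ^ 3 = algebraMap (adjoin k {z'}) E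
              (2 * ⟨z', mem_adjoin_simple_self k z'⟩ ^ 3 - 1) := by
            rw [map_sub, map_mul, map_pow, map_one, map_ofNat]
            exact eq_sub_of_add_eq' hzw'.symm
          rw [this]
          exact isIntegral_algebraMap
        have h1 := isAlgebraic_adjoin (K := adjoin k {z'}) (S := {w'}) (by simpa using hw)
        have h2 : adjoin (adjoin k {z'}) {w'} = ⊤ := by
          apply restrictScalars_injective k
          rw [adjoin_adjoin_left, restrictScalars_top, ← htop]
          rfl
        rw [h2] at h1
        exact topEquiv.isAlgebraic_iff.mp h1
      simpa using Algebra.IsAlgebraic.trdeg_le_cardinalMk k {z'}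
    · rw [Cardinal.one_le_iff_ne_zero, Ne, trdeg_eq_zero_iff]
      intro h
      exact hz' (hclosed z' (h.isAlgebraic z').isIntegral)

end PowerSeriesCurve

/-! ### Non-unirational examples in every dimension at least 3 -/

theorem AlgHom.two_mul_pow_three_eq {k L M : Type*} [Field k] [Field L] [Field M] [Algebra k L]
    [Algebra k M] (φ : L →ₐ[k] M) {z w : L} (h : 2 * z ^ 3 = 1 + w ^ 3) :
    2 * φ z ^ 3 = 1 + φ w ^ 3 := by
  have h' := congrArg φ h
  rwa [map_mul, map_add, map_pow, map_pow, map_one, map_ofNat] at h'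

theorem AlgHom.mem_range_of_apply_mem_range {k L M : Type*} [Field k] [Field L] [Field M]
    [Algebra k L] [Algebra k M] (φ : L →ₐ[k] M) {z : L} (h : φ z ∈ (algebraMap k M).range) :
    z ∈ (algebraMap k L).range := by
  obtain ⟨c, hc⟩ := h
  exact ⟨c, φ.toRingHom.injective ((φ.commutes c).trans hc)⟩

theorem not_isUnirationalOver_of_two_mul_pow_three (k : Type u) (B : Type v) [Field k] [CharZero k]
    [CommRing B] [IsDomain B] [Algebra k B] {z w : FractionRing B} (h : 2 * z ^ 3 = 1 + w ^ 3)
    (hz : z ∉ (algebraMap k (FractionRing B)).range) : ¬ IsUnirationalOver k B := by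
  rintro ⟨F, _, _, hF, ⟨φ⟩⟩
  exact hz (φ.mem_range_of_apply_mem_range
    (hF.mem_range_of_two_mul_pow_three (φ.two_mul_pow_three_eq h)))

theorem IsRationalOver.isUnirationalOver {k : Type u} {B : Type u} [Field k]
    [CommRing B] [IsDomain B] [Algebra k B] (h : IsRationalOver k B) : IsUnirationalOver k B :=
  ⟨FractionRing B, inferInstance, inferInstance, h, ⟨AlgHom.id _ _⟩⟩

/-- The induction carries a nonconstant point of the cubic, which passes along Frac B → Frac B[T]
and obstructs unirationality. -/
theorem exists_normal_trivial_makarLimanov (k : Type u) [Field k] [CharZero k] (n : ℕ) :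
    ∃ (B : Type u) (_ : CommRing B) (_ : IsDomain B) (_ : Algebra k B),
      Algebra.FiniteType k B ∧ IsIntegrallyClosed B ∧ ringKrullDim B = (n + 3 : ℕ) ∧
      makarLimanov B = (algebraMap k B).range ∧
      ∃ z w : FractionRing B, 2 * z ^ 3 = 1 + w ^ 3 ∧
        z ∉ (algebraMap k (FractionRing B)).range := by
  induction n with
  | zero =>
    obtain ⟨K, _, _, hFG, hcl, htr, z, w, hzw, hz⟩ := exists_functionField_two_mul_pow_three k
    obtain ⟨s, hfin, hs⟩ := IntermediateField.fg_def.mp hFG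
    have := (isConeLike_normalCone (k := k) s).isFractionRing hs
    have hft := finiteType_normalCone hfin hs
    refine ⟨normalCone k s, inferInstance, inferInstance, inferInstance, hft,
      isIntegrallyClosed_normalCone hs, ?_, ?_, ?_⟩
    · obtain ⟨n, hn, hn'⟩ := exists_ringKrullDim_eq_trdeg k (normalCone k s)
      rw [← trdeg_eq_of_isFractionRing k (normalCone k s) (RatFunc₂ K), trdeg_ratFunc₂, htr] at hn'
      rw [hn]
      have : n = 3 := by
        have : (n : Cardinal) = (3 : ℕ) := by
          rw [← hn']
          norm_num
        exact_mod_cast this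
      rw [this]
    · have : CharZero (normalCone k s) :=
        charZero_of_injective_algebraMap (algebraMap k (normalCone k s)).injective
      refine le_antisymm (fun b hb => ?_) (algebraMap_range_le_makarLimanov k)
      have h : algebraMap (normalCone k s) (RatFunc₂ K) b ∈
          (makarLimanov (normalCone k s)).map (algebraMap (normalCone k s) (RatFunc₂ K)) :=
        ⟨b, hb, rfl⟩
      rw [map_makarLimanov_normalCone, hcl] at h
      obtain ⟨_, ⟨c, rfl⟩, hc⟩ := h
      exact ⟨c, Subtype.ext hc⟩
    · let e : RatFunc₂ K ≃ₐ[normalCone k s] FractionRing (normalCone k s) :=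
        (FractionRing.algEquiv _ _).symm
      let φ : K →ₐ[k] FractionRing (normalCone k s) :=
        (e.toAlgHom.restrictScalars k).comp (IsScalarTower.toAlgHom k K (RatFunc₂ K))
      exact ⟨φ z, φ w, φ.two_mul_pow_three_eq hzw, mt φ.mem_range_of_apply_mem_range hz⟩
  | succ n ih =>
    obtain ⟨B, _, _, _, hft, hic, hdim, hML, z, w, hzw, hz⟩ := ih
    have : IsNoetherianRing B := Algebra.FiniteType.isNoetherianRing k B
    have : CharZero B := charZero_of_injective_algebraMap (algebraMap k B).injective
    refine ⟨Polynomial B, inferInstance, inferInstance, inferInstance, .trans hft inferInstance,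
      inferInstance, ?_, ?_, ?_⟩
    · rw [Polynomial.ringKrullDim_of_isNoetherianRing, hdim]
      norm_cast
    · refine le_antisymm (fun p hp => ?_) (algebraMap_range_le_makarLimanov k)
      obtain ⟨b, hb, rfl⟩ := makarLimanov_polynomial_le hp
      rw [hML] at hb
      obtain ⟨c, rfl⟩ := hb
      exact ⟨c, rfl⟩
    · let g : B →ₐ[k] FractionRing (Polynomial B) :=
        (IsScalarTower.toAlgHom k (Polynomial B) (FractionRing (Polynomial B))).comp
          Polynomial.CAlgHom
      have hg : Function.Injective g :=
        (IsFractionRing.injective (Polynomial B) (FractionRing (Polynomial B))).comp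
          Polynomial.C_injective
      let φ : FractionRing B →ₐ[k] FractionRing (Polynomial B) := IsFractionRing.liftAlgHom hg
      exact ⟨φ z, φ w, φ.two_mul_pow_three_eq hzw, mt φ.mem_range_of_apply_mem_range hz⟩

theorem mainTheorem7 (k : Type u) [Field k] [CharZero k] :
    (∀ (K : Type v) [Field K] [Algebra k K], (⊤ : IntermediateField k K).FG →
      (∃ (B : Subalgebra k (RatFunc₂ K)) (_ : IsFractionRing B (RatFunc₂ K)),
        Algebra.FiniteType k B ∧
        makarLimanov B = (algebraMap k B).range ∧
        (algebraMap K (RatFunc₂ K)).fieldRange ∈ fieldLattice B (RatFunc₂ K)) ∧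
      (∃ (B : Subalgebra k (RatFunc₂ K)) (_ : IsFractionRing B (RatFunc₂ K)),
        Algebra.FiniteType k B ∧
        IsIntegrallyClosed B ∧
        (makarLimanov B).map (algebraMap B (RatFunc₂ K)) =
          (algebraicClosure k K).toSubalgebra.toSubring.map (algebraMap K (RatFunc₂ K)) ∧
        (algebraMap K (RatFunc₂ K)).fieldRange ∈ fieldLattice B (RatFunc₂ K))) ∧
    (∀ d : ℕ, 3 ≤ d →
      ∃ (B : Type u) (_ : CommRing B) (_ : IsDomain B) (_ : Algebra k B),
        Algebra.FiniteType k B ∧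
        IsIntegrallyClosed B ∧
        ringKrullDim B = d ∧
        makarLimanov B = (algebraMap k B).range ∧
        ¬ IsUnirationalOver k B ∧
        ¬ IsRationalOver k B) := by
  refine ⟨fun K _ _ hFG => ?_, fun d hd => ?_⟩
  · obtain ⟨s, hfin, hs⟩ := IntermediateField.fg_def.mp hFG
    have : CharZero K := charZero_of_injective_algebraMap (algebraMap k K).injective
    have h₁ := isConeLike_map_coneAlgebra (k := k) s
    have h₂ := isConeLike_normalCone (k := k) s
    have hf₁ := h₁.isFractionRing hs
    have hf₂ := h₂.isFractionRing hs
    refine ⟨⟨_, hf₁, ?_, makarLimanov_map_coneAlgebra s, h₁.fieldRange_mem_fieldLattice hs⟩,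
      ⟨_, hf₂, finiteType_normalCone hfin hs, isIntegrallyClosed_normalCone hs,
        map_makarLimanov_normalCone s, h₂.fieldRange_mem_fieldLattice hs⟩⟩
    exact Subalgebra.fg_iff_finiteType _ |>.mp <|
      (Subalgebra.fg_iff_finiteType _ |>.mpr (finiteType_coneAlgebra hfin)).map _
  · obtain ⟨n, rfl⟩ := Nat.exists_eq_add_of_le' hd
    obtain ⟨B, _, _, _, hft, hic, hdim, hML, z, w, hzw, hz⟩ :=
      exists_normal_trivial_makarLimanov k n
    have hu := not_isUnirationalOver_of_two_mul_pow_three k B hzw hz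
    exact ⟨B, inferInstance, inferInstance, inferInstance, hft, hic, hdim, hML, hu,
      fun h => hu h.isUnirationalOver⟩
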